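/- **Theorem (WAY theorem for projective measurements and group symmetries).** Let $\mathcal H_S,\mathcal H_P,\mathcal H_{S'},\mathcal H_{P'}$ be complex Hilbert spaces of arbitrary (finite or infinite) dimension, let $\otimes$ denote the Hilbert space tensor product, and let $(\Omega,\Sigma)$ be a measurable space. A POVM on $\mathcal H$ is a map $\mathsf E\colon\Sigma\to\mathbf B(\mathcal H)$ with $\mathsf E(X)\ge 0$ for all $X\in\Sigma$, $\mathsf E(\varnothing)=0$, $\mathsf E(\Omega)=\mathbb 1$, and $\mathsf E(\bigcup_k X_k)=\sum_k\mathsf E(X_k)$ in the weak operator topology for every sequence $(X_k)$ of pairwise disjoint sets in $\Sigma$; it is a PVM if every $\mathsf E(X)$ is an (orthogonal) projection. Let $\rho_P$ be a density operator on $\mathcal H_P$ (a non-negative trace-class operator with unit trace), let $U\colon\mathcal H_S\otimes\mathcal H_P\to\mathcal H_{S'}\otimes\mathcal H_{P'}$ be a unitary operator, and let $\mathsf F_{P'}\colon\Sigma\to\mathbf B(\mathcal H_{P'})$ be a POVM. Let $\mathsf E_S\colon\Sigma\to\mathbf B(\mathcal H_S)$ be a PVM that is implemented by the measurement model $(\mathcal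 H_P,\mathcal H_{S'},\mathcal H_{P'},\rho_P,U,(\Omega,\Sigma,\mathsf F_{P'}))$, i.e. $$\mathsf E_S(X)=\mathrm{Tr}_P\big[(\mathbb 1_S\otimes\rho_P)\,U^\dagger(\mathbb 1_{S'}\otimes\mathsf F_{P'}(X))\,U\big]\qquad(X\in\Sigma),$$ where $\mathrm{Tr}_P$ is the partial trace: $\langle\xi,\mathrm{Tr}_P[B]\,\eta\rangle=\sum_i\langle\xi\otimes e_i,B(\eta\otimes e_i)\rangle$ for $\xi,\eta\in\mathcal H_S$ and an orthonormal basis $(e_i)$ of $\mathcal H_P$. Let $G$ be a connected topological group and let $(U^S_g)_{g\in G}$, $(U^P_g)_{g\in G}$, $(U^{S'}_g)_{g\in G}$, $(U^{P'}_g)_{g\in G}$ be unitary representations of $G$ (group homomorphisms into the unitary operators, with no continuity required unless stated) on $\mathcal H_S,\mathcal H_P,\mathcal H_{S'},\mathcal H_{P'}$, respectively. Suppose that: 1. $(U^P_g)_{g\in G}$ is strongly continuous, i.e. $g\mapsto U^P_g\xi$ is continuous for every $\xi\in\mathcal H_P$; 2. ($G$-invariance) $U^\dagger(U^{S'}_g\otimes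 U^{P'}_g)U=U^S_g\otimes U^P_g$ for every $g\in G$; 3. (generalized Yanase condition) $\mathsf F_{P'}(X)$ commutes with $U^{P'}_g$ for every $X\in\Sigma$ and every $g\in G$. Then $\mathsf E_S(X)$ commutes with $U^S_g$ for every $X\in\Sigma$ and every $g\in G$. -/

import Mathlib

open scoped TensorProduct InnerProductSpace

noncomputable section

namespace WAY

/-- The Hilbert space tensor product: the completion of the algebraic tensor product for the inner
product determined by `⟪a ⊗ₜ b, c ⊗ₜ d⟫ = ⟪a, c⟫ * ⟪b, d⟫`. -/
abbrev HilbertTensor (H K : Type*)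
    [NormedAddCommGroup H] [InnerProductSpace ℂ H]
    [NormedAddCommGroup K] [InnerProductSpace ℂ K] : Type _ :=
  UniformSpace.Completion (H ⊗[ℂ] K)

section Operators

variable {H K : Type*}
  [NormedAddCommGroup H] [InnerProductSpace ℂ H]
  [NormedAddCommGroup K] [InnerProductSpace ℂ K]

/-- The tensor product `A ⊗ B` of bounded operators, acting on the Hilbert tensor product: the
continuous extension of `x ⊗ₜ y ↦ A x ⊗ₜ B y`. -/
def opTensor (A : H →L[ℂ] H) (B : K →L[ℂ] K) : HilbertTensor H K →L[ℂ] HilbertTensor H K :=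
  (TensorProduct.mapL A B).completion

theorem opTensor_tmul (A : H →L[ℂ] H) (B : K →L[ℂ] K) (x : H) (y : K) :
    opTensor A B ((x ⊗ₜ[ℂ] y : H ⊗[ℂ] K) : HilbertTensor H K) =
      ((A x ⊗ₜ[ℂ] B y : H ⊗[ℂ] K) : HilbertTensor H K) := by
  simp [opTensor]

variable (K) in
/-- For `ξ : H`, the bounded operator `K → H ⊗ K`, `y ↦ ξ ⊗ y`. -/
def tensorLeft (ξ : H) : K →L[ℂ] HilbertTensor H K :=
  UniformSpace.Completion.toComplL ∘L TensorProduct.mkL ℂ H K ξ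

theorem tensorLeft_apply (ξ : H) (y : K) :
    tensorLeft K ξ y = ((ξ ⊗ₜ[ℂ] y : H ⊗[ℂ] K) : HilbertTensor H K) := rfl

end Operators

section Trace

variable (H : Type*) [NormedAddCommGroup H] [InnerProductSpace ℂ H] [CompleteSpace H]

/-- The index set of a fixed orthonormal (Hilbert) basis of `H`. -/
def stdBasisIndex : Set H := (exists_hilbertBasis ℂ H).choose

/-- A fixed orthonormal (Hilbert) basis of `H`. -/
def stdBasis : HilbertBasis (stdBasisIndex H) ℂ H := (exists_hilbertBasis ℂ H).choose_spec.choose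

variable {H}

/-- `T` is of trace class: `∑ᵢ ⟪eᵢ, |T| eᵢ⟫ < ∞`, where `|T| = (T† T)^{1/2}`. (This does not depend
on the orthonormal basis.) -/
def IsTraceClass (T : H →L[ℂ] H) : Prop :=
  Summable fun i => ⟪stdBasis H i, CFC.abs T (stdBasis H i)⟫_ℂ

/-- The trace `∑ᵢ ⟪eᵢ, T eᵢ⟫`. It is only used for operators of trace class, for which the series
converges absolutely and does not depend on the orthonormal basis. -/
def trace (T : H →L[ℂ] H) : ℂ := ∑' i, ⟪stdBasis H i, T (stdBasis H i)⟫_ℂ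

/-- A density operator: a non-negative operator of trace class with unit trace. -/
structure IsDensityOperator (ρ : H →L[ℂ] H) : Prop where
  nonneg : 0 ≤ ρ
  traceClass : IsTraceClass ρ
  trace_eq_one : trace ρ = 1

/-- `T = Tr_K B` for an operator `B` on `H ⊗ K`: for all `ξ, η` the operator `V_ξ† B V_η` on `K`,
with `V_η y = η ⊗ y`, is of trace class and its trace, i.e. `∑ᵢ ⟪ξ ⊗ eᵢ, B (η ⊗ eᵢ)⟫`, is the matrix
element `⟪ξ, T η⟫`. These matrix elements determine `T`. (`B` itself need not be of trace class;
the condition on `V_ξ† B V_η` holds automatically for `B = (1 ⊗ ρ) A` with `ρ` of trace class.) -/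
def IsPartialTrace {K : Type*} [NormedAddCommGroup K] [InnerProductSpace ℂ K] [CompleteSpace K]
    (B : HilbertTensor H K →L[ℂ] HilbertTensor H K) (T : H →L[ℂ] H) : Prop :=
  ∀ ξ η : H,
    IsTraceClass ((tensorLeft K ξ).adjoint ∘L B ∘L tensorLeft K η) ∧
      trace ((tensorLeft K ξ).adjoint ∘L B ∘L tensorLeft K η) = ⟪ξ, T η⟫_ℂ

end Trace

/-- A positive operator-valued measure on the measurable space `Ω`, acting on `H`. Only the values
on measurable sets matter. The sum over a disjoint sequence is taken in the weak operator
topology. -/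
structure POVM (Ω : Type*) [MeasurableSpace Ω]
    (H : Type*) [NormedAddCommGroup H] [InnerProductSpace ℂ H] [CompleteSpace H] where
  effect : Set Ω → H →L[ℂ] H
  nonneg : ∀ X, MeasurableSet X → 0 ≤ effect X
  empty : effect ∅ = 0
  univ : effect Set.univ = 1
  iUnion : ∀ X : ℕ → Set Ω, (∀ k, MeasurableSet (X k)) → Pairwise (Function.onFun Disjoint X) →
    HasSum (fun k => ContinuousLinearMapWOT.ofCLM (effect (X k)))
      (ContinuousLinearMapWOT.ofCLM (effect (⋃ k, X k)))

/-- A projection-valued measure: a POVM whose values are orthogonal projections. -/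
structure POVM.IsPVM {Ω : Type*} [MeasurableSpace Ω]
    {H : Type*} [NormedAddCommGroup H] [InnerProductSpace ℂ H] [CompleteSpace H]
    (E : POVM Ω H) : Prop where
  isStarProjection : ∀ X, MeasurableSet X → IsStarProjection (E.effect X)

/-- A measurement model for a system `S` with input probe `P`, output system `S'`, and output
probe `P'`: the probe state, the unitary interaction, and the pointer POVM on the output probe. -/
structure MeasurementModel (Ω : Type*) [MeasurableSpace Ω] (S P S' P' : Type*)
    [NormedAddCommGroup S] [InnerProductSpace ℂ S] [CompleteSpace S]
    [NormedAddCommGroup P] [InnerProductSpace ℂ P] [CompleteSpace P]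
    [NormedAddCommGroup S'] [InnerProductSpace ℂ S'] [CompleteSpace S']
    [NormedAddCommGroup P'] [InnerProductSpace ℂ P'] [CompleteSpace P'] where
  probe : P →L[ℂ] P
  isDensityOperator : IsDensityOperator probe
  U : HilbertTensor S P ≃ₗᵢ[ℂ] HilbertTensor S' P'
  pointer : POVM Ω P'

namespace MeasurementModel

variable {Ω : Type*} [MeasurableSpace Ω] {S P S' P' : Type*}
  [NormedAddCommGroup S] [InnerProductSpace ℂ S] [CompleteSpace S]
  [NormedAddCommGroup P] [InnerProductSpace ℂ P] [CompleteSpace P]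
  [NormedAddCommGroup S'] [InnerProductSpace ℂ S'] [CompleteSpace S']
  [NormedAddCommGroup P'] [InnerProductSpace ℂ P'] [CompleteSpace P']

/-- The interaction in the Heisenberg picture, `A ↦ U† A U`. -/
def heisenberg (M : MeasurementModel Ω S P S' P')
    (A : HilbertTensor S' P' →L[ℂ] HilbertTensor S' P') :
    HilbertTensor S P →L[ℂ] HilbertTensor S P :=
  (M.U.toContinuousLinearEquiv : HilbertTensor S P →L[ℂ] HilbertTensor S' P').adjoint ∘L A ∘L
    (M.U.toContinuousLinearEquiv : HilbertTensor S P →L[ℂ] HilbertTensor S' P')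

/-- The model implements `E`: `E(X) = Tr_P [(1 ⊗ ρ_P) U† (1 ⊗ F(X)) U]` for all measurable `X`. -/
def Implements (M : MeasurementModel Ω S P S' P') (E : POVM Ω S) : Prop :=
  ∀ X, MeasurableSet X →
    IsPartialTrace (opTensor 1 M.probe ∘L M.heisenberg (opTensor 1 (M.pointer.effect X)))
      (E.effect X)

end MeasurementModel

/-- Strong continuity of a unitary representation: continuity for the topology induced by the
seminorms `a ↦ ‖a ξ‖`. -/
def StronglyContinuous {G : Type*} [Group G] [TopologicalSpace G]
    {H : Type*} [NormedAddCommGroup H] [InnerProductSpace ℂ H] [CompleteSpace H]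
    (V : G →* unitary (H →L[ℂ] H)) : Prop :=
  ∀ ξ : H, Continuous fun g => (V g : H →L[ℂ] H) ξ

end WAY

end

/-!
Let `F(X) = U† (1 ⊗ F_{P'}(X)) U` be the pointer effect in the Heisenberg picture. Since `E(X)` is
a projection, the measurement is free of dispersion. If `E(X) ψ = 0`, then
`Tr (ρ V_ψ† F(X) V_ψ) = ⟪ψ, E(X) ψ⟫ = 0` with `V_ψ y = ψ ⊗ y`. By cyclicity of the trace, this is
the trace of a positive operator, which must vanish, so that `F(X)` annihilates `ψ ⊗ y` for all `y`
in the range of `ρ` (`WAY.IsPartialTrace.apply_tmul_eq_zero`). Applied to `X` and to its complement,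
this gives `F(X) (ψ ⊗ y) = E(X) ψ ⊗ y` for all `ψ`
(`WAY.MeasurementModel.Implements.heisenberg_pointer_tmul`).

By the invariance of `U` and the Yanase condition, `F(X)` commutes with `V_S(g) ⊗ V_P(g)`. Fix a
nonzero `y` in the range of `ρ`. Comparing the matrix elements of both products between `φ ⊗ y` and
`ψ ⊗ y` yields `⟪φ, E(X) V_S(g) ψ⟫ ⟪y, V_P(g) y⟫ = ⟪φ, V_S(g) E(X) ψ⟫ ⟪y, V_P(g) y⟫`, so `E(X)`
commutes with `V_S(g)` whenever `⟪y, V_P(g) y⟫ ≠ 0` (`WAY.commute_of_commute_opTensor`). By strong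
continuity of `V_P` this holds for all `g` near the identity. The `g` for which `E(X)` commutes with
`V_S(g)` form a subgroup, which is therefore open, and hence is all of the connected group `G`.
-/

namespace WAY

/-! ### Hilbert–Schmidt operators and cyclicity of the trace -/

section HilbertSchmidt

variable {ι H : Type*} [NormedAddCommGroup H] [InnerProductSpace ℂ H]

theorem _root_.HilbertBasis.hasSum_norm_inner_sq (b : HilbertBasis ι ℂ H) (x : H) :
    HasSum (fun i => ‖⟪b i, x⟫_ℂ‖ ^ 2) (‖x‖ ^ 2) := by
  have h := (b.hasSum_inner_mul_inner x x).mapL RCLike.reCLM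
  simp only [inner_mul_symm_re_eq_norm, RCLike.reCLM_apply, inner_self_eq_norm_sq] at h
  refine h.congr_fun fun i => ?_
  rw [norm_mul, norm_inner_symm, sq]

/-- The matrix entries of a Hilbert–Schmidt operator are square summable. -/
theorem summable_norm_inner_sq (b : HilbertBasis ι ℂ H) {T : H →L[ℂ] H}
    (hT : Summable fun i => ‖T (b i)‖ ^ 2) :
    Summable fun p : ι × ι => ‖⟪b p.2, T (b p.1)⟫_ℂ‖ ^ 2 := by
  refine (summable_prod_of_nonneg fun p => by positivity).2
    ⟨fun i => (b.hasSum_norm_inner_sq (T (b i))).summable, ?_⟩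
  exact hT.congr fun i => (b.hasSum_norm_inner_sq (T (b i))).tsum_eq.symm

theorem summable_norm_sq_comp (b : HilbertBasis ι ℂ H) (A : H →L[ℂ] H) {T : H →L[ℂ] H}
    (hT : Summable fun i => ‖T (b i)‖ ^ 2) : Summable fun i => ‖A (T (b i))‖ ^ 2 := by
  refine (hT.mul_left (‖A‖ ^ 2)).of_nonneg_of_le (fun i => by positivity) fun i => ?_
  rw [← mul_pow]
  gcongr
  exact A.le_opNorm _

variable [CompleteSpace H]

theorem summable_norm_sq_adjoint (b : HilbertBasis ι ℂ H) {T : H →L[ℂ] H}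
    (hT : Summable fun i => ‖T (b i)‖ ^ 2) : Summable fun i => ‖T.adjoint (b i)‖ ^ 2 := by
  have h := ((Equiv.prodComm ι ι).summable_iff.2 (summable_norm_inner_sq b hT)).prod
  refine h.congr fun i => ?_
  rw [← (b.hasSum_norm_inner_sq (T.adjoint (b i))).tsum_eq]
  refine tsum_congr fun j => ?_
  simp [ContinuousLinearMap.adjoint_inner_right, norm_inner_symm]

/-- Cyclicity of the trace, `Tr (T† B) = Tr (B T†)`, for Hilbert–Schmidt operators. -/
theorem hasSum_inner_adjoint (b : HilbertBasis ι ℂ H) {T B : H →L[ℂ] H}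
    (hT : Summable fun i => ‖T (b i)‖ ^ 2) (hB : Summable fun i => ‖B (b i)‖ ^ 2) :
    HasSum (fun i => ⟪B.adjoint (b i), T.adjoint (b i)⟫_ℂ) (∑' i, ⟪T (b i), B (b i)⟫_ℂ) := by
  have hf : Summable fun p : ι × ι => ⟪T (b p.1), b p.2⟫_ℂ * ⟪b p.2, B (b p.1)⟫_ℂ := by
    refine Summable.of_norm_bounded
      ((summable_norm_inner_sq b hT).add (summable_norm_inner_sq b hB)) fun p => ?_
    rw [norm_mul, norm_inner_symm (T _)]
    nlinarith [sq_nonneg (‖⟪b p.2, T (b p.1)⟫_ℂ‖ - ‖⟪b p.2, B (b p.1)⟫_ℂ‖),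
      sq_nonneg ‖⟪b p.2, T (b p.1)⟫_ℂ‖, sq_nonneg ‖⟪b p.2, B (b p.1)⟫_ℂ‖]
  have h1 := hf.hasSum.prod_fiberwise fun i => b.hasSum_inner_mul_inner (T (b i)) (B (b i))
  have h2 := ((Equiv.prodComm ι ι).hasSum_iff.2 hf.hasSum).prod_fiberwise
    (g := fun j => ⟪B.adjoint (b j), T.adjoint (b j)⟫_ℂ) fun j => by
      refine (b.hasSum_inner_mul_inner (B.adjoint (b j)) (T.adjoint (b j))).congr_fun fun i => ?_
      simp [ContinuousLinearMap.adjoint_inner_right, ContinuousLinearMap.adjoint_inner_left,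
        mul_comm]
  rwa [h1.tsum_eq]

end HilbertSchmidt

/-! ### Positive operators and density operators -/

section Density

open scoped ComplexOrder

variable {H : Type*} [NormedAddCommGroup H] [InnerProductSpace ℂ H] [CompleteSpace H]

theorem apply_eq_zero_of_inner_eq_zero {A : H →L[ℂ] H} (hA : 0 ≤ A) {x : H}
    (h : ⟪x, A x⟫_ℂ = 0) : A x = 0 := by
  have hs : (CFC.sqrt A).IsPositive :=
    (ContinuousLinearMap.nonneg_iff_isPositive _).1 (CFC.sqrt_nonneg A)
  have hm : ∀ z, A z = CFC.sqrt A (CFC.sqrt A z) := fun z => by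
    conv_lhs => rw [← CFC.sqrt_mul_sqrt_self A hA]
    rfl
  rw [hm, ← hs.inner_left_eq_inner_right, inner_self_eq_zero] at h
  rw [hm, h, map_zero]

theorem IsDensityOperator.summable_norm_sqrt_sq {ρ : H →L[ℂ] H} (hρ : IsDensityOperator ρ) :
    Summable fun i => ‖CFC.sqrt ρ (stdBasis H i)‖ ^ 2 := by
  have hs : (CFC.sqrt ρ).IsPositive :=
    (ContinuousLinearMap.nonneg_iff_isPositive _).1 (CFC.sqrt_nonneg ρ)
  have h := hρ.traceClass
  rw [IsTraceClass, CFC.abs_of_nonneg ρ hρ.nonneg] at h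
  refine (h.mapL RCLike.reCLM).congr fun i => ?_
  conv_lhs => rw [← CFC.sqrt_mul_sqrt_self ρ hρ.nonneg]
  rw [mul_apply_eq_comp, ← hs.inner_left_eq_inner_right, RCLike.reCLM_apply,
    inner_self_eq_norm_sq]

theorem IsDensityOperator.ne_zero {ρ : H →L[ℂ] H} (hρ : IsDensityOperator ρ) : ρ ≠ 0 := by
  rintro rfl
  simpa [trace] using hρ.trace_eq_one

/-- If a positive operator `A` has vanishing expectation in the state `ρ`, it vanishes on the range
of `ρ`: indeed `Tr (ρ A) = Tr (ρ^{1/2} A ρ^{1/2})` is a sum of non-negative terms. -/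
theorem IsDensityOperator.apply_eq_zero_of_trace_eq_zero {ρ : H →L[ℂ] H}
    (hρ : IsDensityOperator ρ) {A : H →L[ℂ] H} (hA : 0 ≤ A) (h : trace (ρ ∘L A) = 0) (x : H) :
    A (ρ x) = 0 := by
  set Q := CFC.sqrt ρ with hQ
  have hs : Q.IsPositive := (ContinuousLinearMap.nonneg_iff_isPositive _).1 (CFC.sqrt_nonneg ρ)
  have hAp := (ContinuousLinearMap.nonneg_iff_isPositive _).1 hA
  have hm : ∀ z, ρ z = Q (Q z) := fun z => by
    conv_lhs => rw [← CFC.sqrt_mul_sqrt_self ρ hρ.nonneg]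
    rfl
  have hQs : Summable fun i => ‖Q (stdBasis H i)‖ ^ 2 := hρ.summable_norm_sqrt_sq
  have hadj : (A ∘L Q).adjoint = Q ∘L A := by
    rw [ContinuousLinearMap.adjoint_comp, hs.isSelfAdjoint.adjoint_eq,
      hAp.isSelfAdjoint.adjoint_eq]
  have hB : Summable fun i => ‖(Q ∘L A) (stdBasis H i)‖ ^ 2 := by
    rw [← hadj]
    exact summable_norm_sq_adjoint _ (summable_norm_sq_comp _ A hQs)
  have hsum := hasSum_inner_adjoint _ hQs hB
  have htr : ∑' i, ⟪Q (stdBasis H i), (Q ∘L A) (stdBasis H i)⟫_ℂ = 0 := by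
    rw [← h, trace]
    refine tsum_congr fun i => ?_
    simp [hm, hs.inner_left_eq_inner_right]
  rw [htr, ← hadj, ContinuousLinearMap.adjoint_adjoint, hs.isSelfAdjoint.adjoint_eq] at hsum
  have hz : ∀ i, A (Q (stdBasis H i)) = 0 := fun i => by
    refine apply_eq_zero_of_inner_eq_zero hA ?_
    have := congrFun ((hasSum_zero_iff_of_nonneg fun i => hAp.inner_nonneg_left _).1 hsum) i
    rw [← hAp.inner_left_eq_inner_right]
    exact this
  have hAQ : A ∘L Q = 0 :=
    ContinuousLinearMap.ext_on
      (Submodule.dense_iff_topologicalClosure_eq_top.2 (stdBasis H).dense_span)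
      (by rintro _ ⟨i, rfl⟩; exact hz i)
  rw [hm]
  exact DFunLike.congr_fun hAQ (Q x)

end Density

/-! ### Operators on the Hilbert tensor product -/

section Tensor

variable {H K : Type*}
  [NormedAddCommGroup H] [InnerProductSpace ℂ H]
  [NormedAddCommGroup K] [InnerProductSpace ℂ K]

theorem HilbertTensor.clm_ext {L : Type*} [NormedAddCommGroup L] [NormedSpace ℂ L]
    {A B : HilbertTensor H K →L[ℂ] L}
    (h : ∀ x y, A ((x ⊗ₜ[ℂ] y : H ⊗[ℂ] K) : HilbertTensor H K) =
      B ((x ⊗ₜ[ℂ] y : H ⊗[ℂ] K) : HilbertTensor H K)) : A = B := by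
  ext z
  induction z using UniformSpace.Completion.induction_on with
  | hp => exact isClosed_eq A.continuous B.continuous
  | ih z =>
    induction z using TensorProduct.induction_on with
    | zero => simpa only [TensorProduct.zero_tmul] using h 0 0
    | tmul x y => exact h x y
    | add x y hx hy => rw [UniformSpace.Completion.coe_add, map_add, map_add, hx, hy]

theorem opTensor_mul (A A' : H →L[ℂ] H) (B B' : K →L[ℂ] K) :
    opTensor (A * A') (B * B') = opTensor A B * opTensor A' B' :=
  HilbertTensor.clm_ext fun x y => by simp [opTensor_tmul]

theorem opTensor_one_one : opTensor (1 : H →L[ℂ] H) (1 : K →L[ℂ] K) = 1 :=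
  HilbertTensor.clm_ext fun x y => by simp [opTensor_tmul]

theorem opTensor_one_sub (B B' : K →L[ℂ] K) :
    opTensor (1 : H →L[ℂ] H) (B - B') = opTensor 1 B - opTensor 1 B' :=
  HilbertTensor.clm_ext fun x y => by
    simp [opTensor_tmul, TensorProduct.tmul_sub, UniformSpace.Completion.coe_sub]

variable [CompleteSpace H] [CompleteSpace K]

theorem adjoint_opTensor (A : H →L[ℂ] H) (B : K →L[ℂ] K) :
    (opTensor A B).adjoint = opTensor A.adjoint B.adjoint := by
  refine HilbertTensor.clm_ext fun x y => ?_
  refine ext_inner_left ℂ fun z => ?_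
  -- Both sides are values at `z` of conjugates of continuous functionals.
  rw [ContinuousLinearMap.adjoint_inner_right, ← inner_conj_symm, ← inner_conj_symm z]
  congr 1
  refine DFunLike.congr_fun (f := innerSL ℂ _ ∘L opTensor A B) (g := innerSL ℂ _) ?_ z
  refine HilbertTensor.clm_ext fun x' y' => ?_
  simp [opTensor_tmul, UniformSpace.Completion.inner_coe, TensorProduct.inner_tmul,
    ContinuousLinearMap.adjoint_inner_left]

theorem opTensor_one_nonneg {B : K →L[ℂ] K} (hB : 0 ≤ B) : 0 ≤ opTensor (1 : H →L[ℂ] H) B := by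
  have hs : (CFC.sqrt B).IsPositive :=
    (ContinuousLinearMap.nonneg_iff_isPositive _).1 (CFC.sqrt_nonneg B)
  have h : opTensor (1 : H →L[ℂ] H) B =
      (opTensor 1 (CFC.sqrt B)).adjoint ∘L opTensor 1 (CFC.sqrt B) := by
    rw [adjoint_opTensor, hs.isSelfAdjoint.adjoint_eq, ContinuousLinearMap.adjoint_one]
    rw [← ContinuousLinearMap.mul_def, ← opTensor_mul, CFC.sqrt_mul_sqrt_self B hB, one_mul]
  rw [h, ContinuousLinearMap.nonneg_iff_isPositive]
  exact ContinuousLinearMap.isPositive_adjoint_comp_self _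

theorem adjoint_tensorLeft_comp_opTensor_one (ξ : H) (B : K →L[ℂ] K) :
    (tensorLeft K ξ).adjoint ∘L opTensor 1 B = B ∘L (tensorLeft K ξ).adjoint := by
  rw [← ContinuousLinearMap.adjoint_adjoint (_ ∘L opTensor 1 B),
    ← ContinuousLinearMap.adjoint_adjoint (B ∘L _)]
  congr 1
  simp only [ContinuousLinearMap.adjoint_comp, ContinuousLinearMap.adjoint_adjoint,
    adjoint_opTensor, ContinuousLinearMap.adjoint_one]
  ext y
  simp [tensorLeft_apply, opTensor_tmul]

/-- If the partial trace `T` of `(1 ⊗ ρ) A`, with `A` positive, annihilates `ψ`, then `A`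
annihilates `ψ ⊗ y` for all `y` in the range of the density operator `ρ`. -/
theorem IsPartialTrace.apply_tmul_eq_zero {ρ : K →L[ℂ] K} (hρ : IsDensityOperator ρ)
    {A : HilbertTensor H K →L[ℂ] HilbertTensor H K} (hA : 0 ≤ A) {T : H →L[ℂ] H}
    (hT : IsPartialTrace (opTensor 1 ρ ∘L A) T) {ψ : H} (hψ : T ψ = 0) (y : K) :
    A (tensorLeft K ψ (ρ y)) = 0 := by
  have hAp := (ContinuousLinearMap.nonneg_iff_isPositive _).1 hA
  have htr := (hT ψ ψ).2
  rw [hψ, inner_zero_right, ContinuousLinearMap.comp_assoc, ← ContinuousLinearMap.comp_assoc,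
    adjoint_tensorLeft_comp_opTensor_one, ContinuousLinearMap.comp_assoc] at htr
  have h := hρ.apply_eq_zero_of_trace_eq_zero
    ((ContinuousLinearMap.nonneg_iff_isPositive _).2 (hAp.adjoint_conj (tensorLeft K ψ))) htr y
  refine apply_eq_zero_of_inner_eq_zero hA ?_
  rw [← ContinuousLinearMap.adjoint_inner_right]
  simp only [ContinuousLinearMap.comp_apply] at h
  rw [h, inner_zero_right]

end Tensor

/-! ### Positive operator-valued measures -/

theorem POVM.effect_compl {Ω : Type*} [MeasurableSpace Ω]
    {H : Type*} [NormedAddCommGroup H] [InnerProductSpace ℂ H] [CompleteSpace H]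
    (E : POVM Ω H) {X : Set Ω} (hX : MeasurableSet X) : E.effect Xᶜ = 1 - E.effect X := by
  let s : ℕ → Set Ω := fun k => if k = 0 then X else if k = 1 then Xᶜ else ∅
  have hs : ∀ k, MeasurableSet (s k) := fun k => by
    dsimp only [s]; split_ifs <;> measurability
  have hd : Pairwise (Function.onFun Disjoint s) := fun i j hij => by
    dsimp only [Function.onFun, s]
    split_ifs <;> simp_all [disjoint_compl_right, disjoint_compl_left]
  have hU : ⋃ k, s k = Set.univ := by
    refine Set.eq_univ_of_forall fun x => Set.mem_iUnion.2 ?_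
    by_cases hx : x ∈ X
    · exact ⟨0, by simpa [s]⟩
    · exact ⟨1, by simpa [s]⟩
  have h1 := E.iUnion s hs hd
  have h2 : HasSum (fun k => ContinuousLinearMapWOT.ofCLM (E.effect (s k)))
      (∑ k ∈ Finset.range 2, ContinuousLinearMapWOT.ofCLM (E.effect (s k))) := by
    refine hasSum_sum_of_ne_finset_zero fun k hk => ?_
    have hk2 : 2 ≤ k := not_lt.1 fun h => hk (Finset.mem_range.2 h)
    have : s k = ∅ := by simp only [s]; rw [if_neg (by omega), if_neg (by omega)]
    rw [this, E.empty, ContinuousLinearMapWOT.ofCLM_zero]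
  have h := h1.unique h2
  rw [hU, E.univ, Finset.sum_range_succ, Finset.sum_range_one,
    ← ContinuousLinearMapWOT.ofCLM_add] at h
  have h3 := ContinuousLinearMapWOT.ofCLM_injective h
  simp only [s, if_true, one_ne_zero, if_false] at h3
  rw [h3, add_sub_cancel_left]

/-! ### Measurement models -/

namespace MeasurementModel

variable {Ω : Type*} [MeasurableSpace Ω] {S P S' P' : Type*}
  [NormedAddCommGroup S] [InnerProductSpace ℂ S] [CompleteSpace S]
  [NormedAddCommGroup P] [InnerProductSpace ℂ P] [CompleteSpace P]
  [NormedAddCommGroup S'] [InnerProductSpace ℂ S'] [CompleteSpace S']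
  [NormedAddCommGroup P'] [InnerProductSpace ℂ P'] [CompleteSpace P']
  (M : MeasurementModel Ω S P S' P')

theorem heisenberg_apply (A : HilbertTensor S' P' →L[ℂ] HilbertTensor S' P')
    (z : HilbertTensor S P) : M.heisenberg A z = M.U.symm (A (M.U z)) := by
  refine ext_inner_left ℂ fun w => ?_
  rw [heisenberg, ContinuousLinearMap.comp_apply, ContinuousLinearMap.adjoint_inner_right,
    ← M.U.inner_map_map w]
  simp

theorem heisenberg_mul (A B : HilbertTensor S' P' →L[ℂ] HilbertTensor S' P') :
    M.heisenberg (A * B) = M.heisenberg A * M.heisenberg B := by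
  ext z
  simp [heisenberg_apply]

theorem heisenberg_nonneg {A : HilbertTensor S' P' →L[ℂ] HilbertTensor S' P'} (hA : 0 ≤ A) :
    0 ≤ M.heisenberg A :=
  (ContinuousLinearMap.nonneg_iff_isPositive _).2
    (((ContinuousLinearMap.nonneg_iff_isPositive _).1 hA).adjoint_conj _)

variable {M}

/-- A model implementing a PVM does so without dispersion: the Heisenberg-evolved pointer effect
acts on `ψ ⊗ y`, for `y` in the range of the probe state, as the measured projection on `ψ`. -/
theorem Implements.heisenberg_pointer_tmul {E : POVM Ω S} (hE : E.IsPVM) (hM : M.Implements E)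
    {X : Set Ω} (hX : MeasurableSet X) (ψ : S) (y : P) :
    M.heisenberg (opTensor 1 (M.pointer.effect X)) (tensorLeft P ψ (M.probe y)) =
      tensorLeft P (E.effect X ψ) (M.probe y) := by
  have key : ∀ {Y : Set Ω}, MeasurableSet Y → ∀ {φ : S}, E.effect Y φ = 0 →
      M.heisenberg (opTensor 1 (M.pointer.effect Y)) (tensorLeft P φ (M.probe y)) = 0 :=
    fun {Y} hY {φ} hφ => (hM Y hY).apply_tmul_eq_zero M.isDensityOperator
      (M.heisenberg_nonneg (opTensor_one_nonneg (M.pointer.nonneg Y hY))) hφ y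
  have hidem : E.effect X (E.effect X ψ) = E.effect X ψ :=
    DFunLike.congr_fun (hE.isStarProjection X hX).isIdempotentElem.eq ψ
  have h0 := key hX (φ := ψ - E.effect X ψ) (by rw [map_sub, hidem, sub_self])
  have h1 := key hX.compl (φ := E.effect X ψ) (by simp [E.effect_compl hX, hidem])
  rw [M.pointer.effect_compl hX, opTensor_one_sub, opTensor_one_one, heisenberg_apply,
    sub_apply, map_sub, one_apply_eq_self,
    LinearIsometryEquiv.symm_apply_apply, ← heisenberg_apply, sub_eq_zero] at h1
  rw [h1, ← sub_eq_zero, ← map_sub, ← h0]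
  congr 1
  simp [tensorLeft_apply, TensorProduct.sub_tmul, UniformSpace.Completion.coe_sub]

end MeasurementModel

/-! ### Commutation with group representations -/

/-- Let a self-adjoint `A` on `H ⊗ K` act on vectors `ψ ⊗ y`, for some fixed `y`, as `E ψ ⊗ y`.
If `A` commutes with `V ⊗ W` and `⟪y, W y⟫ ≠ 0`, then `E` commutes with `V`: compare
`⟪A (φ ⊗ y), (V ⊗ W) (ψ ⊗ y)⟫ = ⟪E φ, V ψ⟫ ⟪y, W y⟫` with
`⟪φ ⊗ y, (V ⊗ W) A (ψ ⊗ y)⟫ = ⟪φ, V E ψ⟫ ⟪y, W y⟫`. -/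
theorem commute_of_commute_opTensor {H K : Type*}
    [NormedAddCommGroup H] [InnerProductSpace ℂ H] [CompleteSpace H]
    [NormedAddCommGroup K] [InnerProductSpace ℂ K] [CompleteSpace K]
    {A : HilbertTensor H K →L[ℂ] HilbertTensor H K} (hA : IsSelfAdjoint A)
    {E : H →L[ℂ] H} (hE : IsSelfAdjoint E) {y : K}
    (h : ∀ ψ, A (tensorLeft K ψ y) = tensorLeft K (E ψ) y) {V : H →L[ℂ] H} {W : K →L[ℂ] K}
    (hAVW : Commute A (opTensor V W)) (hy : ⟪y, W y⟫_ℂ ≠ 0) : Commute E V := by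
  have hinner : ∀ (φ φ' : H) (z z' : K),
      ⟪tensorLeft K φ z, tensorLeft K φ' z'⟫_ℂ = ⟪φ, φ'⟫_ℂ * ⟪z, z'⟫_ℂ := fun φ φ' z z' => by
    simp [tensorLeft_apply, UniformSpace.Completion.inner_coe, TensorProduct.inner_tmul]
  have hVW : ∀ ψ z, opTensor V W (tensorLeft K ψ z) = tensorLeft K (V ψ) (W z) :=
    fun ψ z => opTensor_tmul V W ψ z
  ext ψ
  refine ext_inner_left ℂ fun φ => mul_right_cancel₀ hy ?_
  change ⟪φ, E (V ψ)⟫_ℂ * _ = ⟪φ, V (E ψ)⟫_ℂ * _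
  rw [← hinner, ← hinner, ← hVW (E ψ), ← h, ← mul_apply_eq_comp (opTensor V W), ← hAVW.eq,
    mul_apply_eq_comp, ← ContinuousLinearMap.adjoint_inner_left A, hA.adjoint_eq, h, hVW,
    hinner, hinner, ← ContinuousLinearMap.adjoint_inner_left E, hE.adjoint_eq]

/-- The elements of a group that are represented by operators commuting with `A`. -/
def commutant {G H : Type*} [Group G]
    [NormedAddCommGroup H] [InnerProductSpace ℂ H] [CompleteSpace H]
    (V : G →* unitary (H →L[ℂ] H)) (A : H →L[ℂ] H) : Subgroup G where
  carrier := {g | Commute A (V g : H →L[ℂ] H)}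
  one_mem' := by simp
  mul_mem' := fun {a b} ha hb => by simpa using Commute.mul_right ha hb
  inv_mem' := fun {a} ha => by
    rw [Set.mem_ofPred_eq, map_inv]
    exact Commute.units_inv_right (u := Unitary.toUnits (V a)) ha

theorem _root_.Subgroup.eq_top_of_mem_nhds_one {G : Type*} [Group G] [TopologicalSpace G]
    [IsTopologicalGroup G] [ConnectedSpace G] {N : Subgroup G} (h : (N : Set G) ∈ nhds 1) :
    N = ⊤ := by
  have ho : IsOpen (N : Set G) := N.isOpen_of_mem_nhds h
  exact SetLike.coe_injective (IsClopen.eq_univ ⟨N.isClosed_of_isOpen ho, ho⟩ ⟨1, N.one_mem⟩)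

end WAY

theorem theoremS1
    {Ω : Type*} [MeasurableSpace Ω] {S P S' P' : Type*}
    [NormedAddCommGroup S] [InnerProductSpace ℂ S] [CompleteSpace S]
    [NormedAddCommGroup P] [InnerProductSpace ℂ P] [CompleteSpace P]
    [NormedAddCommGroup S'] [InnerProductSpace ℂ S'] [CompleteSpace S']
    [NormedAddCommGroup P'] [InnerProductSpace ℂ P'] [CompleteSpace P']
    (M : WAY.MeasurementModel Ω S P S' P')
    (E : WAY.POVM Ω S) (hE : E.IsPVM) (hM : M.Implements E)
    {G : Type*} [Group G] [TopologicalSpace G] [IsTopologicalGroup G] [ConnectedSpace G]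
    (VS : G →* unitary (S →L[ℂ] S)) (VP : G →* unitary (P →L[ℂ] P))
    (VS' : G →* unitary (S' →L[ℂ] S')) (VP' : G →* unitary (P' →L[ℂ] P'))
    (hVP : WAY.StronglyContinuous VP)
    (hinv : ∀ g : G,
      M.heisenberg (WAY.opTensor (VS' g : S' →L[ℂ] S') (VP' g : P' →L[ℂ] P')) =
        WAY.opTensor (VS g : S →L[ℂ] S) (VP g : P →L[ℂ] P))
    (hYanase : ∀ X, MeasurableSet X → ∀ g : G,
      Commute (M.pointer.effect X) (VP' g : P' →L[ℂ] P')) :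
    ∀ X, MeasurableSet X → ∀ g : G, Commute (E.effect X) (VS g : S →L[ℂ] S) := by
  intro X hX
  obtain ⟨x, hx⟩ : ∃ x, M.probe x ≠ 0 := by
    by_contra! h
    exact M.isDensityOperator.ne_zero (ContinuousLinearMap.ext h)
  have hF : IsSelfAdjoint (M.heisenberg (WAY.opTensor 1 (M.pointer.effect X))) :=
    IsSelfAdjoint.of_nonneg
      (M.heisenberg_nonneg (WAY.opTensor_one_nonneg (M.pointer.nonneg X hX)))
  have hcomm : ∀ g, Commute (M.heisenberg (WAY.opTensor 1 (M.pointer.effect X)))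
      (WAY.opTensor (VS g : S →L[ℂ] S) (VP g : P →L[ℂ] P)) := fun g => by
    rw [← hinv, Commute, SemiconjBy, ← M.heisenberg_mul, ← M.heisenberg_mul,
      ← WAY.opTensor_mul, ← WAY.opTensor_mul, (hYanase X hX g).eq, one_mul, mul_one]
  have hnear : (WAY.commutant VS (E.effect X) : Set G) ∈ nhds 1 := by
    have hcont : Continuous fun g => ⟪M.probe x, (VP g : P →L[ℂ] P) (M.probe x)⟫_ℂ :=
      continuous_const.inner (hVP (M.probe x))
    -- At `g = 1` the matrix element is `‖ρ x‖ ^ 2 ≠ 0`, so it is nonzero near `1`.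
    filter_upwards [hcont.continuousAt.eventually_ne (x := 1) (y := 0) (by simpa using hx)] with g hg
    exact WAY.commute_of_commute_opTensor hF (hE.isStarProjection X hX).isSelfAdjoint
      (fun ψ => hM.heisenberg_pointer_tmul hE hX ψ x) (hcomm g) hg
  intro g
  have hg : g ∈ WAY.commutant VS (E.effect X) := by
    rw [Subgroup.eq_top_of_mem_nhds_one hnear]
    exact Subgroup.mem_top g
  exact hg
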